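/- **Setting.** Networks are finite connected undirected unweighted graphs. A routing function $R$ on an $n$-node network $G$ uses a labelling of the nodes by $1,\dots,n$ and, at each node $u$, a numbering of the edges at $u$ by ports $1,\dots,\deg(u)$ (both arbitrary, and they may be chosen depending on $G$), and it consists of a local routing function $R_u$ for each node $u$. A message from $u$ to $v$ starts at $u$ with the label of $v$ as its header and with input port $0$; a node $w$ that receives a message with header $h$ through its port $p$ (with $p=0$ at the start) forwards it, with header $h'$, through its port $p'$, where $(p',h')=R_w(p,h)$. Headers are arbitrary finite tuples of natural numbers. For $u\neq v$, routing from $u$ to $v$ has stretch $<3$ if the message reaches $v$ after fewer than $3\,d(u,v)$ hops. Given a programming language $U$ (a partial computable interpreter of programs that are binary strings), the memory requirement of a node $u$ is the length of the shortest program that computes $R_u$ (infinite if there is none), and the total memory requirement of $R$ is the sum of the memory requirements of all nodes. **Theorem (essentially Gavoille and Gengler).** For general networks, a total memory requirement of $\Omega(n^2)$ is needed for routing with stretch $<3$ for almost all pairs. That is, there is a constant $c>0$ such that for every programming language $U$ there are connected networks $G_n$ with $n$ nodes ($n\ge 1$) with the following property: if, for each $n$, $R_n$ is a routing function on $G_n$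 (with any node and port labelling), and if, for $u,v$ chosen independently and uniformly at random from the nodes of $G_n$, the probability that $u=v$ or that $R_n$ routes from $u$ to $v$ with stretch $<3$ tends to $1$ as $n\to\infty$, then for all sufficiently large $n$ the total memory requirement of $R_n$ is at least $c\,n^2$. -/

import Mathlib

open Filter Topology
open scoped ENNReal

/-- The headers that messages carry: finite tuples of natural numbers. -/
abbrev Header : Type := List ℕ

/-- A programming language for local routing functions, given by its interpreter: programs are
binary strings, and `eval w (p, h)` is the result (if any) of running program `w` on input port `p`
and header `h`, namely an output port and a new header. The interpreter is partial computable. -/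
structure ProgLang where
  eval : List Bool → ℕ × Header →. ℕ × Header
  partrec : Partrec₂ eval

/-- A local routing function `R_u = (P_u, H_u)`: it sends an input port and a header to an output
port and a new header. It need only be defined on the inputs that the node has to handle
(`none` means undefined). -/
abbrev LocalRouting : Type := ℕ → Header → Option (ℕ × Header)

/-- The program `w` computes `f`: on every input on which `f` is defined, `w` halts with that
value. -/
def ProgLang.Computes (U : ProgLang) (w : List Bool) (f : LocalRouting) : Prop :=
  ∀ (p : ℕ) (h : Header) (r : ℕ × Header), f p h = some r → r ∈ U.eval w (p, h)

/-- The memory requirement of a local routing function: the length of the smallest program that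
computes it (`⊤` if there is none). -/
noncomputable def ProgLang.memory (U : ProgLang) (f : LocalRouting) : ℕ∞ :=
  ⨅ (w : List Bool) (_ : U.Computes w f), (w.length : ℕ∞)

/-- A routing function on the network `G`, together with the labels of the nodes and of the ports
that it uses. -/
structure RoutingFunction {V : Type*} [Fintype V] (G : SimpleGraph V) where
  /-- the label of each node; the labels are `1, …, |V|` -/
  label : V → ℕ
  label_bij : Set.BijOn label Set.univ (Set.Icc 1 (Fintype.card V))
  /-- `port u v` is the port number at `u` of the edge from `u` to its neighbour `v`
  (irrelevant if `v` is not a neighbour); the ports at `u` are `1, …, deg u` -/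
  port : V → V → ℕ
  port_bij : ∀ u : V,
    Set.BijOn (port u) (G.neighborSet u) (Set.Icc 1 (G.neighborSet u).ncard)
  /-- the local routing function of each node -/
  loc : V → LocalRouting

namespace RoutingFunction

variable {V : Type*} [Fintype V] {G : SimpleGraph V}

/-- A message for `v` that starts at `u`, with the label of `v` as its header and with input port
`0`, is at `v` after exactly `k` hops. Here `node i`, `inPort i`, `header i` are the position of
the message, the port of `node i` through which it arrived there, and the header it carries, after
`i` hops. -/
def RoutesIn (R : RoutingFunction G) (u v : V) (k : ℕ) : Prop :=
  ∃ (node : ℕ → V) (inPort : ℕ → ℕ) (header : ℕ → Header),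
    node 0 = u ∧ inPort 0 = 0 ∧ header 0 = [R.label v] ∧ node k = v ∧
    ∀ i < k, G.Adj (node i) (node (i + 1)) ∧
      R.loc (node i) (inPort i) (header i) =
        some (R.port (node i) (node (i + 1)), header (i + 1)) ∧
      inPort (i + 1) = R.port (node (i + 1)) (node i)

/-- The route from `u` to `v` reaches `v`, and it is less than `s` times as long as a shortest
path. -/
def StretchLT (R : RoutingFunction G) (s : ℝ) (u v : V) : Prop :=
  ∃ k : ℕ, R.RoutesIn u v k ∧ (k : ℝ) < s * (G.dist u v : ℝ)

/-- The probability that routing from `u` to `v` has stretch `< s`, for `u` and `v` chosen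
independently and uniformly at random (nothing is asked of a pair with `u = v`). -/
noncomputable def stretchProb (R : RoutingFunction G) (s : ℝ) : ℝ :=
  ({x : V × V | x.1 ≠ x.2 → R.StretchLT s x.1 x.2}.ncard : ℝ) / (Fintype.card V : ℝ) ^ 2

/-- The total memory requirement: the sum of the memory requirements of the nodes. -/
noncomputable def totalMemory (R : RoutingFunction G) (U : ProgLang) : ℕ∞ :=
  ∑ u : V, U.memory (R.loc u)

end RoutingFunction

/-! Information-theoretic counting on bipartite graphs. In a bipartite graph a route between
adjacent nodes has odd length, so stretch `< 3` forces the edge itself (`StretchLT.loc_eq`). Hence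
the program at a left node `i`, run on the label of a neighbour `j`, must output the port of the
edge `ij`, for all but a few bad pairs.

Port numberings are arbitrary, and recording them would cost about `m ^ 2 * log m` bits, too many.
Only this is kept: on the good neighbours of `i`, the output port is injective with values in `{1,
…, deg i}`. If `deg i` is at most about `m / 2`, a fixed function admits only about `3 ^ (m / 2)`
such sets (`card_injSets_le`), whereas about `2 ^ m` neighbourhoods are possible.

So labels, programs and the set of bad edges fix the graph up to about `3 ^ (m * m / 2)` choices
(`exists_code`). Labels contribute only `(n + 1) ^ m`; with short programs and few bad pairs the
total falls below the number of graphs (`card_halfSets_pow_le`, `counting_bound_of_le`). -/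

/-! ### Counting lemmas -/

/-- The maximum of `(1 + x) ^ 2 / 2 ^ x` over the naturals is `9 / 4`, attained at `x = 2`. -/
theorem four_mul_succ_sq_le (x : ℕ) : 4 * (1 + x) ^ 2 ≤ 9 * 2 ^ x := by
  rcases Nat.lt_or_ge x 3 with h | h
  · interval_cases x <;> norm_num
  · induction x, h using Nat.le_induction with
    | base => norm_num
    | succ x hx ih =>
      rw [pow_succ 2 x]
      nlinarith

/-- The sets on which `g` is injective with values in `{1, …, D}`. -/
noncomputable def injSets {m : ℕ} (g : Fin m → ℕ) (D : ℕ) : Finset (Finset (Fin m)) :=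
  open Classical in
  Finset.univ.filter fun S => Set.InjOn g S ∧ ∀ j ∈ S, g j ∈ Set.Icc 1 D

/-- An admissible set takes at most one point from each fibre of `g` over `1, …, D`, and these
choices determine it. -/
theorem card_injSets_le_prod {m : ℕ} (g : Fin m → ℕ) (D : ℕ) :
    (injSets g D).card ≤
      ∏ i ∈ Finset.Icc 1 D, (1 + (Finset.univ.filter fun j => g j = i).card) := by
  classical
  let F : ℕ → Finset (Finset (Fin m)) := fun i =>
    insert ∅ ((Finset.univ.filter fun j => g j = i).image fun j => {j})
  have hF : ∀ i, (F i).card ≤ 1 + (Finset.univ.filter fun j => g j = i).card := fun i => by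
    refine (Finset.card_insert_le _ _).trans ?_
    rw [add_comm]
    gcongr
    exact Finset.card_image_le
  refine le_trans ?_ (Finset.prod_le_prod' fun i _ => hF i)
  rw [← Finset.card_pi]
  refine Finset.card_le_card_of_injOn (fun S i _ => S.filter fun j => g j = i) ?_ ?_
  · intro S hS
    simp only [injSets, Finset.coe_filter, Finset.mem_univ, true_and, Set.mem_ofPred_eq] at hS
    simp only [Finset.mem_coe, Finset.mem_pi]
    intro i _
    rcases (S.filter fun j => g j = i).eq_empty_or_nonempty with h | ⟨j, hj⟩
    · simp [F, h]
    · refine Finset.mem_insert_of_mem (Finset.mem_image.2 ⟨j, ?_, ?_⟩)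
      · simpa using (Finset.mem_filter.1 hj).2
      · ext x
        simp only [Finset.mem_filter, Finset.mem_singleton] at hj ⊢
        constructor
        · rintro rfl
          exact hj
        · rintro ⟨hx, hgx⟩
          exact hS.1 hx hj.1 (hgx.trans hj.2.symm)
  · intro S hS S' hS' h
    simp only [injSets, Finset.coe_filter, Finset.mem_univ, true_and, Set.mem_ofPred_eq] at hS hS'
    have key : ∀ j, g j ∈ Set.Icc 1 D → (j ∈ S ↔ j ∈ S') := fun j hj => by
      have := congrFun (congrFun h (g j)) (Finset.mem_Icc.2 hj)
      simpa using Finset.ext_iff.1 this j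
    ext j
    exact ⟨fun hj => (key j (hS.2 j hj)).1 hj, fun hj => (key j (hS'.2 j hj)).2 hj⟩

theorem card_injSets_sq_le {m : ℕ} (g : Fin m → ℕ) (D : ℕ) :
    4 ^ D * (injSets g D).card ^ 2 ≤ 9 ^ D * 2 ^ m := by
  classical
  calc 4 ^ D * (injSets g D).card ^ 2
      ≤ 4 ^ D * (∏ i ∈ Finset.Icc 1 D, (1 + (Finset.univ.filter fun j => g j = i).card)) ^ 2 := by
        gcongr
        exact card_injSets_le_prod g D
    _ = ∏ i ∈ Finset.Icc 1 D, (4 * (1 + (Finset.univ.filter fun j => g j = i).card) ^ 2) := by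
        simp [Finset.prod_mul_distrib, Finset.prod_pow]
    _ ≤ ∏ i ∈ Finset.Icc 1 D, (9 * 2 ^ (Finset.univ.filter fun j => g j = i).card) :=
        Finset.prod_le_prod' fun i _ => four_mul_succ_sq_le _
    _ = 9 ^ D * 2 ^ (∑ i ∈ Finset.Icc 1 D, (Finset.univ.filter fun j => g j = i).card) := by
        simp [Finset.prod_mul_distrib, Finset.prod_pow_eq_pow_sum]
    _ ≤ 9 ^ D * 2 ^ m := by
        gcongr
        · norm_num
        · have := Finset.card_biUnion (s := Finset.Icc 1 D)
            (t := fun i => Finset.univ.filter fun j => g j = i) (fun i _ i' _ h => by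
              refine Finset.disjoint_left.2 fun j hj hj' => h ?_
              rw [← (Finset.mem_filter.1 hj).2, (Finset.mem_filter.1 hj').2])
          rw [← this]
          exact (Finset.card_le_univ _).trans (by simp)

/-- The nested square roots are an integer fourth root, so the bound is about `3 ^ (m / 2)`. The
slack `4` in `hD` pays for the two hubs and costs `(9 / 4) ^ 4 < 26`. -/
theorem card_injSets_le {m D : ℕ} (g : Fin m → ℕ) (hD : 2 * D ≤ m + 4) :
    (injSets g D).card ≤ Nat.sqrt (Nat.sqrt (26 * 9 ^ m)) := by
  rw [Nat.le_sqrt', Nat.le_sqrt']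
  have h := card_injSets_sq_le g D
  generalize (injSets g D).card = x at h ⊢
  have h1 : (4 ^ D * x ^ 2 : ℝ) ≤ 9 ^ D * 2 ^ m := by exact_mod_cast h
  have h2 : (x ^ 2 : ℝ) ≤ (9 / 4) ^ D * 2 ^ m := by
    rw [div_pow, div_mul_eq_mul_div, le_div_iff₀ (by positivity)]
    linarith
  have h3 : ((x ^ 2) ^ 2 : ℝ) ≤ 26 * 9 ^ m :=
    calc ((x ^ 2) ^ 2 : ℝ) ≤ ((9 / 4) ^ D * 2 ^ m) ^ 2 := by gcongr
      _ = (9 / 4) ^ (2 * D) * 4 ^ m := by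
        rw [mul_pow, ← pow_mul, ← pow_mul, mul_comm D, mul_comm m, pow_mul 2]; norm_num
      _ ≤ (9 / 4) ^ (m + 4) * 4 ^ m := by
        gcongr
        norm_num
      _ = (9 / 4) ^ 4 * 9 ^ m := by
        rw [pow_add, mul_right_comm, ← mul_pow]; norm_num; ring
      _ ≤ 26 * 9 ^ m := by gcongr; norm_num
  exact_mod_cast h3

/-! ### Counting program tuples and sparse sets by weights -/

/-- The binary strings of length at most `M`. -/
noncomputable def shortStrings (M : ℕ) : Finset (List Bool) :=
  (List.finite_length_le Bool M).toFinset

theorem mem_shortStrings {M : ℕ} {w : List Bool} : w ∈ shortStrings M ↔ w.length ≤ M := by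
  simp [shortStrings]

theorem sum_shortStrings_le (M : ℕ) :
    ∑ w ∈ shortStrings M, (1 / 4 : ℝ) ^ w.length ≤ 2 := by
  classical
  have hmap : ∀ w ∈ shortStrings M, w.length ∈ Finset.range (M + 1) := fun w hw => by
    have := mem_shortStrings.1 hw
    simp; omega
  rw [← Finset.sum_fiberwise_of_maps_to hmap]
  calc ∑ l ∈ Finset.range (M + 1), ∑ w ∈ shortStrings M with w.length = l, (1 / 4 : ℝ) ^ w.length
      ≤ ∑ l ∈ Finset.range (M + 1), (1 / 2 : ℝ) ^ l := by
        refine Finset.sum_le_sum fun l _ => ?_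
        rw [Finset.sum_congr rfl (g := fun _ => (1 / 4 : ℝ) ^ l)
          fun w hw => by rw [(Finset.mem_filter.1 hw).2]]
        have hc : ((shortStrings M).filter fun w => w.length = l).card ≤ 2 ^ l := by
          have : ((shortStrings M).filter fun w => w.length = l) ⊆
              (Finset.univ : Finset (List.Vector Bool l)).image List.Vector.toList := fun w hw =>
            Finset.mem_image.2 ⟨⟨w, (Finset.mem_filter.1 hw).2⟩, Finset.mem_univ _, rfl⟩
          refine (Finset.card_le_card this).trans (Finset.card_image_le.trans ?_)
          rw [Finset.card_univ, card_vector, Fintype.card_bool]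
        have hc' : (((shortStrings M).filter fun w => w.length = l).card : ℝ) ≤ 2 ^ l := by
          exact_mod_cast hc
        rw [Finset.sum_const, nsmul_eq_mul]
        calc _ ≤ (2 : ℝ) ^ l * (1 / 4) ^ l := by gcongr
          _ = (1 / 2) ^ l := by rw [← mul_pow]; norm_num
    _ ≤ 2 := by
        have := sum_geometric_two_le (M + 1)
        exact this

/-- The `m`-tuples of binary strings of total length at most `M`. -/
noncomputable def programTuples (m M : ℕ) : Finset (Fin m → List Bool) :=
  (Fintype.piFinset fun _ => shortStrings M).filter fun w => ∑ i, (w i).length ≤ M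

theorem mem_programTuples {m M : ℕ} {w : Fin m → List Bool} :
    w ∈ programTuples m M ↔ ∑ i, (w i).length ≤ M := by
  simp only [programTuples, Finset.mem_filter, Fintype.mem_piFinset, mem_shortStrings,
    and_iff_right_iff_imp]
  exact fun h i => (Finset.single_le_sum (f := fun i => (w i).length) (fun _ _ => Nat.zero_le _)
    (Finset.mem_univ i)).trans h

/-- Weighting each bit by `1 / 4` gives every tuple weight at least `4⁻ᴹ`, while the total weight
factors into `m` sums, each at most `∑ 2 ^ l * 4⁻ˡ ≤ 2`. -/
theorem card_programTuples_le (m M : ℕ) :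
    ((programTuples m M).card : ℝ) ≤ 4 ^ M * 2 ^ m := by
  have h : ((programTuples m M).card : ℝ) * (1 / 4) ^ M ≤ 2 ^ m :=
    calc ((programTuples m M).card : ℝ) * (1 / 4) ^ M
        = ∑ _w ∈ programTuples m M, (1 / 4 : ℝ) ^ M := by simp
      _ ≤ ∑ w ∈ programTuples m M, ∏ i, (1 / 4 : ℝ) ^ (w i).length := by
        refine Finset.sum_le_sum fun w hw => ?_
        rw [Finset.prod_pow_eq_pow_sum]
        exact pow_le_pow_of_le_one (by norm_num) (by norm_num) (mem_programTuples.1 hw)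
      _ ≤ ∑ w ∈ Fintype.piFinset fun _ => shortStrings M, ∏ i, (1 / 4 : ℝ) ^ (w i).length :=
        Finset.sum_le_sum_of_subset_of_nonneg (Finset.filter_subset _ _)
          fun _ _ _ => by positivity
      _ = ∏ _i : Fin m, ∑ w ∈ shortStrings M, (1 / 4 : ℝ) ^ w.length :=
        (Finset.prod_univ_sum (fun _ => shortStrings M)
          fun _ w => (1 / 4 : ℝ) ^ w.length).symm
      _ ≤ ∏ _i : Fin m, (2 : ℝ) := by
        refine Finset.prod_le_prod (fun _ _ => Finset.sum_nonneg fun _ _ => by positivity)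
          fun _ _ => sum_shortStrings_le M
      _ = 2 ^ m := by simp
  rw [one_div, inv_pow, mul_inv_le_iff₀ (by positivity)] at h
  linarith

/-- The same weighting with `1 / 16` per element; the binomial theorem evaluates the total weight.
-/
theorem card_small_subsets_le {α : Type*} [Fintype α] [DecidableEq α] (s : ℕ) :
    (((Finset.univ : Finset (Finset α)).filter fun S => S.card ≤ s).card : ℝ) ≤
      16 ^ s * (17 / 16) ^ Fintype.card α := by
  have h : (((Finset.univ : Finset (Finset α)).filter fun S => S.card ≤ s).card : ℝ) *
      (1 / 16) ^ s ≤ (17 / 16) ^ Fintype.card α :=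
    calc _ = ∑ _S ∈ (Finset.univ : Finset (Finset α)).filter fun S => S.card ≤ s,
          (1 / 16 : ℝ) ^ s := by simp
      _ ≤ ∑ S ∈ (Finset.univ : Finset (Finset α)).filter fun S => S.card ≤ s,
          (1 / 16 : ℝ) ^ S.card :=
        Finset.sum_le_sum fun S hS =>
          pow_le_pow_of_le_one (by norm_num) (by norm_num) (Finset.mem_filter.1 hS).2
      _ ≤ ∑ S : Finset α, (1 / 16 : ℝ) ^ S.card :=
        Finset.sum_le_sum_of_subset_of_nonneg (Finset.filter_subset _ _)
          fun _ _ _ => by positivity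
      _ = (17 / 16) ^ Fintype.card α := by
        have := Fintype.sum_pow_mul_eq_add_pow α (1 / 16 : ℝ) 1
        simp only [one_pow, mul_one] at this
        rw [this]; norm_num
  rw [one_div, inv_pow, mul_inv_le_iff₀ (by positivity)] at h
  linarith

/-- The subsets of `{0, …, m - 1}` with at most half of the elements. -/
def halfSets (m : ℕ) : Finset (Finset (Fin m)) :=
  Finset.univ.filter fun S => 2 * S.card ≤ m

theorem two_pow_le_two_mul_card_halfSets (m : ℕ) : 2 ^ m ≤ 2 * (halfSets m).card := by
  -- A set or its complement has at most half of the elements.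
  have hcover : (Finset.univ : Finset (Finset (Fin m))) ⊆
      halfSets m ∪ (halfSets m).image fun S => Sᶜ := fun S _ => by
    rw [Finset.mem_union, Finset.mem_image]
    have hc := S.card_add_card_compl
    rw [Fintype.card_fin] at hc
    by_cases h : 2 * S.card ≤ m
    · exact Or.inl (by simpa [halfSets] using h)
    · exact Or.inr ⟨Sᶜ, by simp only [halfSets, Finset.mem_filter, Finset.mem_univ, true_and]; omega,
        compl_compl S⟩
  have h := Finset.card_le_card hcover
  have h1 := Finset.card_union_le (halfSets m) ((halfSets m).image fun S => Sᶜ)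
  have h2 : ((halfSets m).image fun S => Sᶜ).card ≤ (halfSets m).card := Finset.card_image_le
  rw [Finset.card_univ, Fintype.card_finset, Fintype.card_fin] at h
  omega

/-! ### The networks -/

/-- The bipartite graph on `{0, …, n - 1}` with sides `{0, …, m}` and `{m + 1, …, n - 1}` in which
`i < m` is adjacent to `m + 1 + j`, `j < m`, if `j ∈ E i`, and in which `m` and the nodes from
`2 * m + 1` on are adjacent to the whole opposite side. -/
def hubGraph (n : ℕ) {m : ℕ} (E : Fin m → Finset (Fin m)) : SimpleGraph (Fin n) :=
  SimpleGraph.fromRel fun u v => u.val ≤ m ∧ m < v.val ∧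
    (u.val = m ∨ 2 * m + 1 ≤ v.val ∨
      ∃ i j : Fin m, u.val = i.val ∧ v.val = m + 1 + j.val ∧ j ∈ E i)

/-- The `i`-th node of the left side. -/
def leftNode {n m : ℕ} (hn : 2 * m + 2 ≤ n) (i : Fin m) : Fin n := ⟨i.val, by omega⟩

/-- The `j`-th node of the right side. -/
def rightNode {n m : ℕ} (hn : 2 * m + 2 ≤ n) (j : Fin m) : Fin n := ⟨m + 1 + j.val, by omega⟩

theorem leftNode_injective {n m : ℕ} (hn : 2 * m + 2 ≤ n) :
    Function.Injective (leftNode (m := m) hn) := fun i i' h => by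
  simpa [leftNode, Fin.ext_iff] using h

theorem rightNode_injective {n m : ℕ} (hn : 2 * m + 2 ≤ n) :
    Function.Injective (rightNode (m := m) hn) := fun i i' h => by
  simpa [rightNode, Fin.ext_iff] using h

variable {n m : ℕ} {E : Fin m → Finset (Fin m)}

theorem hubGraph_adj_sides {u v : Fin n} (h : (hubGraph n E).Adj u v) :
    u.val ≤ m ↔ ¬ v.val ≤ m := by
  rw [hubGraph, SimpleGraph.fromRel_adj] at h
  rcases h.2 with h | h <;> omega

theorem hubGraph_adj_left_right (hn : 2 * m + 2 ≤ n) {i j : Fin m} (h : j ∈ E i) :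
    (hubGraph n E).Adj (leftNode hn i) (rightNode hn j) := by
  rw [hubGraph, SimpleGraph.fromRel_adj]
  refine ⟨fun h => ?_, Or.inl ⟨?_, ?_, Or.inr (Or.inr ⟨i, j, rfl, rfl, h⟩)⟩⟩
  · have := congrArg Fin.val h
    simp only [leftNode, rightNode] at this
    omega
  · simp only [leftNode]; omega
  · simp only [rightNode]; omega

theorem hubGraph_connected (hn : 2 * m + 2 ≤ n) : (hubGraph n E).Connected := by
  have hl : ∀ u v : Fin n, u.val = m → m < v.val → (hubGraph n E).Adj u v := fun u v hu hv => by
    rw [hubGraph, SimpleGraph.fromRel_adj]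
    exact ⟨fun h => by rw [h] at hu; omega, Or.inl ⟨hu.le, hv, Or.inl hu⟩⟩
  have hr : ∀ u v : Fin n, u.val ≤ m → v.val = 2 * m + 1 → (hubGraph n E).Adj u v :=
    fun u v hu hv => by
      rw [hubGraph, SimpleGraph.fromRel_adj]
      exact ⟨fun h => by rw [h] at hu; omega, Or.inl ⟨hu, by omega, Or.inr (Or.inl hv.ge)⟩⟩
  rw [SimpleGraph.connected_iff_exists_forall_reachable]
  refine ⟨⟨m, by omega⟩, fun v => ?_⟩
  by_cases hv : v.val ≤ m
  · exact (hl ⟨m, by omega⟩ ⟨2 * m + 1, by omega⟩ rfl (by simp only; omega)).reachable.trans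
      (hr v ⟨2 * m + 1, by omega⟩ hv rfl).symm.reachable
  · exact (hl ⟨m, by omega⟩ v rfl (by omega)).reachable

theorem ncard_neighborSet_leftNode_le (hn : 2 * m + 2 ≤ n) (hn' : n ≤ 2 * m + 3) (i : Fin m) :
    ((hubGraph n E).neighborSet (leftNode hn i)).ncard ≤ (E i).card + 2 := by
  classical
  -- The two extra nodes are the right-hand hubs; they coincide when `n = 2 * m + 2`.
  let T : Finset (Fin n) := (E i).image (rightNode hn) ∪
    {⟨2 * m + 1, by omega⟩, ⟨n - 1, by omega⟩}
  have hT : T.card ≤ (E i).card + 2 :=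
    (Finset.card_union_le _ _).trans (add_le_add Finset.card_image_le Finset.card_le_two)
  refine le_trans ?_ hT
  rw [← Set.ncard_coe_finset]
  refine Set.ncard_le_ncard (fun v hv => ?_) (Finset.finite_toSet _)
  rw [SimpleGraph.mem_neighborSet, hubGraph, SimpleGraph.fromRel_adj] at hv
  have hi := i.isLt
  have hvn := v.isLt
  rw [Finset.mem_coe, Finset.mem_union, Finset.mem_image]
  rcases hv.2 with ⟨_, _, h | h | ⟨i', j, h1, h2, h3⟩⟩ | ⟨_, h, _⟩
  · simp only [leftNode] at h; omega
  · right
    simp only [Finset.mem_insert, Finset.mem_singleton, Fin.ext_iff]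
    omega
  · left
    obtain rfl : i = i' := Fin.ext h1
    exact ⟨j, h3, Fin.ext h2.symm⟩
  · simp only [leftNode] at h; omega

/-! ### Routing with stretch less than three -/

/-- Between the ends of an edge, a route of stretch less than three in `hubGraph` is the edge. -/
theorem RoutingFunction.StretchLT.loc_eq {R : RoutingFunction (hubGraph n E)} {u v : Fin n}
    (hadj : (hubGraph n E).Adj u v) (h : R.StretchLT 3 u v) :
    ∃ h', R.loc u 0 [R.label v] = some (R.port u v, h') := by
  obtain ⟨k, ⟨node, inPort, header, h0, hp, hh, hk, hstep⟩, hlt⟩ := h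
  rw [SimpleGraph.dist_eq_one_iff_adj.2 hadj] at hlt
  have hk3 : k < 3 := by
    have : (k : ℝ) < (3 : ℕ) := by norm_num at hlt ⊢; exact hlt
    exact_mod_cast this
  have hs := hubGraph_adj_sides hadj
  interval_cases k
  · exact absurd (h0.symm.trans hk) hadj.ne
  · refine ⟨header 1, ?_⟩
    have := (hstep 0 one_pos).2.1
    rwa [h0, hp, hh, hk] at this
  -- Two hops return to the side of `u`, but `v` is on the other side.
  · have h1 := hubGraph_adj_sides (hstep 0 (by norm_num)).1
    have h2 := hubGraph_adj_sides (hstep 1 (by norm_num)).1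
    rw [h0] at h1
    rw [show (1 : ℕ) + 1 = 2 from rfl, hk] at h2
    rw [show (0 : ℕ) + 1 = 1 from rfl] at h1
    tauto

/-- The output port of program `w` at the start of a message for the node with label `l`
(`0` if the program does not halt). -/
noncomputable def ProgLang.firstPort (U : ProgLang) (w : List Bool) (l : ℕ) : ℕ :=
  open Classical in
  if h : (U.eval w (0, [l])).Dom then ((U.eval w (0, [l])).get h).1 else 0

theorem ProgLang.Computes.firstPort_eq {U : ProgLang} {w : List Bool} {f : LocalRouting}
    (hw : U.Computes w f) {l p : ℕ} {h' : Header} (hf : f 0 [l] = some (p, h')) :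
    U.firstPort w l = p := by
  obtain ⟨hd, he⟩ := hw 0 [l] _ hf
  rw [ProgLang.firstPort, dif_pos hd, he]

theorem ProgLang.exists_computes_of_memory_ne_top {U : ProgLang} {f : LocalRouting}
    (h : U.memory f ≠ ⊤) : ∃ w, U.Computes w f ∧ (w.length : ℕ∞) ≤ U.memory f := by
  have hlt : U.memory f < U.memory f + 1 := (ENat.lt_add_one_iff h).2 le_rfl
  conv_lhs at hlt => rw [ProgLang.memory]
  simp only [iInf_lt_iff] at hlt
  obtain ⟨w, hw, hl⟩ := hlt
  exact ⟨w, hw, (ENat.lt_add_one_iff h).1 hl⟩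

theorem RoutingFunction.exists_programs {V : Type*} [Fintype V] {G : SimpleGraph V}
    (R : RoutingFunction G) (U : ProgLang) {M : ℕ} (h : R.totalMemory U ≤ M) :
    ∃ w : V → List Bool, (∀ u, U.Computes (w u) (R.loc u)) ∧ ∑ u, (w u).length ≤ M := by
  have hfin : ∀ u, U.memory (R.loc u) ≠ ⊤ := fun u hu => by
    have h1 : U.memory (R.loc u) ≤ R.totalMemory U :=
      Finset.single_le_sum (f := fun u => U.memory (R.loc u)) (fun _ _ => zero_le)
        (Finset.mem_univ u)
    rw [hu] at h1
    exact absurd (h1.trans h) (by simp)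
  choose w hw hl using fun u => ProgLang.exists_computes_of_memory_ne_top (hfin u)
  refine ⟨w, hw, ?_⟩
  have : ((∑ u, (w u).length : ℕ) : ℕ∞) ≤ M := by
    rw [Nat.cast_sum]
    exact (Finset.sum_le_sum fun u _ => hl u).trans h
  exact_mod_cast this

/-! ### Reconstructing the network from the programs -/

/-- Here `l` records labels, `w` the programs of the left nodes, `B` the edges routed badly, and
`E'` the remaining edges. The ports of `R` do not enter the code. -/
theorem exists_code {n m M s : ℕ} (hn : 2 * m + 2 ≤ n) (hn' : n ≤ 2 * m + 3)
    {E : Fin m → Finset (Fin m)} (hE : ∀ i, E i ∈ halfSets m) (U : ProgLang)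
    (R : RoutingFunction (hubGraph n E)) (hM : R.totalMemory U ≤ M)
    (hs : {x : Fin n × Fin n | x.1 ≠ x.2 → R.StretchLT 3 x.1 x.2}ᶜ.ncard ≤ s) :
    ∃ l : Fin m → Fin (n + 1), ∃ w ∈ programTuples m M,
      ∃ B : Finset (Fin m × Fin m), B.card ≤ s ∧ ∃ E' : Fin m → Finset (Fin m),
        (∀ i, E' i ∈ injSets (fun j => U.firstPort (w i) (l j)) (m / 2 + 2)) ∧
        E = fun i => E' i ∪ Finset.univ.filter fun j => (i, j) ∈ B := by
  classical
  obtain ⟨w, hw, hwM⟩ := R.exists_programs U hM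
  have hlabel : ∀ v, R.label v < n + 1 := fun v => by
    have := (R.label_bij.mapsTo (Set.mem_univ v)).2
    rw [Fintype.card_fin] at this
    omega
  let good : Fin m → Fin m → Prop := fun i j => R.StretchLT 3 (leftNode hn i) (rightNode hn j)
  have hport : ∀ i j, j ∈ E i → good i j → U.firstPort (w (leftNode hn i))
      (R.label (rightNode hn j)) = R.port (leftNode hn i) (rightNode hn j) := fun i j hj hg => by
    obtain ⟨h', hloc⟩ := hg.loc_eq (hubGraph_adj_left_right hn hj)
    exact (hw _).firstPort_eq hloc
  refine ⟨fun j => ⟨R.label (rightNode hn j), hlabel _⟩, fun i => w (leftNode hn i), ?_,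
    Finset.univ.filter fun x => x.2 ∈ E x.1 ∧ ¬ good x.1 x.2, ?_,
    fun i => (E i).filter fun j => good i j, fun i => ?_, ?_⟩
  · rw [mem_programTuples]
    refine le_trans ?_ hwM
    rw [← Finset.sum_image (s := Finset.univ) (g := leftNode hn) (f := fun u => (w u).length)
      (leftNode_injective hn).injOn]
    exact Finset.sum_le_sum_of_subset (Finset.subset_univ _)
  · refine le_trans ?_ hs
    rw [← Set.ncard_coe_finset]
    refine Set.ncard_le_ncard_of_injOn (fun x => (leftNode hn x.1, rightNode hn x.2)) ?_ ?_
      (Set.toFinite _)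
    · intro x hx
      obtain ⟨hx, hg⟩ := (Finset.mem_filter.1 (Finset.mem_coe.1 hx)).2
      intro h
      exact hg (h (hubGraph_adj_left_right hn hx).ne)
    · intro x _ y _ h
      have h := Prod.ext_iff.1 h
      exact Prod.ext (leftNode_injective hn h.1) (rightNode_injective hn h.2)
  · have hbij := R.port_bij (leftNode hn i)
    have hdeg := ncard_neighborSet_leftNode_le (E := E) hn hn' i
    have hEi := (Finset.mem_filter.1 (hE i)).2
    rw [injSets, Finset.mem_filter]
    refine ⟨Finset.mem_univ _, fun j hj j' hj' h => ?_, fun j hj => ?_⟩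
    · obtain ⟨hj, hg⟩ := Finset.mem_filter.1 (Finset.mem_coe.1 hj)
      obtain ⟨hj', hg'⟩ := Finset.mem_filter.1 (Finset.mem_coe.1 hj')
      simp only at h
      rw [hport i j hj hg, hport i j' hj' hg'] at h
      exact rightNode_injective hn (hbij.injOn (hubGraph_adj_left_right hn hj)
        (hubGraph_adj_left_right hn hj') h)
    · obtain ⟨hj, hg⟩ := Finset.mem_filter.1 hj
      have := hbij.mapsTo (hubGraph_adj_left_right hn hj)
      simp only
      rw [hport i j hj hg]
      exact ⟨this.1, this.2.trans (by omega)⟩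
  · ext i j
    simp only [Finset.mem_union, Finset.mem_filter, Finset.mem_univ, true_and]
    tauto

/-- The graphs are covered by the decodings of all codes `(l, w, B)`; the last factor bounds the
number of graphs sharing a code. -/
theorem card_halfSets_pow_le {n m M s : ℕ} (hn : 2 * m + 2 ≤ n) (hn' : n ≤ 2 * m + 3)
    (U : ProgLang)
    (h : ∀ E : Fin m → Finset (Fin m), (∀ i, E i ∈ halfSets m) →
      ∃ R : RoutingFunction (hubGraph n E), R.totalMemory U ≤ M ∧
        {x : Fin n × Fin n | x.1 ≠ x.2 → R.StretchLT 3 x.1 x.2}ᶜ.ncard ≤ s) :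
    ((halfSets m).card : ℝ) ^ m ≤ (n + 1) ^ m * (4 ^ M * 2 ^ m) *
      (16 ^ s * (17 / 16) ^ (m * m)) * (Nat.sqrt (Nat.sqrt (26 * 9 ^ m)) : ℝ) ^ m := by
  classical
  let codes : Finset ((Fin m → Fin (n + 1)) × (Fin m → List Bool) × Finset (Fin m × Fin m)) :=
    Finset.univ ×ˢ programTuples m M ×ˢ Finset.univ.filter fun B => B.card ≤ s
  let decode : (Fin m → Fin (n + 1)) × (Fin m → List Bool) × Finset (Fin m × Fin m) →
      Finset (Fin m → Finset (Fin m)) := fun c =>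
    (Fintype.piFinset fun i =>
      injSets (fun j => U.firstPort (c.2.1 i) (c.1 j)) (m / 2 + 2)).image
        fun E' i => E' i ∪ Finset.univ.filter fun j => (i, j) ∈ c.2.2
  have hsub : (Fintype.piFinset fun _ : Fin m => halfSets m) ⊆ codes.biUnion decode := by
    intro E hE
    rw [Fintype.mem_piFinset] at hE
    obtain ⟨R, hM, hs⟩ := h E hE
    obtain ⟨l, w, hw, B, hB, E', hE', rfl⟩ := exists_code hn hn' hE U R hM hs
    refine Finset.mem_biUnion.2 ⟨(l, w, B), ?_, ?_⟩
    · simp [codes, hw, hB]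
    · exact Finset.mem_image.2 ⟨E', Fintype.mem_piFinset.2 hE', rfl⟩
  have hdecode : ∀ c ∈ codes, (decode c).card ≤ Nat.sqrt (Nat.sqrt (26 * 9 ^ m)) ^ m :=
    fun c _ => by
      refine Finset.card_image_le.trans ?_
      rw [Fintype.card_piFinset]
      refine (Finset.prod_le_prod' fun i _ => card_injSets_le _ (by omega)).trans ?_
      simp
  have hcard := (Finset.card_le_card hsub).trans (Finset.card_biUnion_le_card_mul _ _ _ hdecode)
  rw [Fintype.card_piFinset_const, Finset.card_product, Finset.card_product, Finset.card_univ,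
    Fintype.card_pi_const, Fintype.card_fin] at hcard
  have hcard' : ((halfSets m).card : ℝ) ^ m ≤ (n + 1) ^ m * ((programTuples m M).card *
      (((Finset.univ : Finset (Finset (Fin m × Fin m))).filter fun B => B.card ≤ s).card : ℝ)) *
      (Nat.sqrt (Nat.sqrt (26 * 9 ^ m)) : ℝ) ^ m := by exact_mod_cast hcard
  refine hcard'.trans ?_
  have h1 := card_programTuples_le m M
  have h2 := card_small_subsets_le (α := Fin m × Fin m) s
  rw [Fintype.card_prod, Fintype.card_fin] at h2
  rw [mul_assoc ((n + 1 : ℝ) ^ m) (4 ^ M * 2 ^ m)]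
  gcongr

/-- Twentieth powers clear the fractional exponents: `4 ^ M` and `16 ^ s` each become at most `2 ^
(m * m)`, and the fourth root gives `3 ^ 10`. The margin is `4 * (17 / 16) ^ 20 * 3 ^ 10 ≤ 2 ^ 20 *
(4 / 5)`; an `m`-th root then leaves a polynomial against `(4 / 5) ^ m`. -/
theorem counting_bound_of_le {n m M s : ℕ} (hn' : n ≤ 2 * m + 3) (hm : 1 ≤ m)
    (hM : 40 * M ≤ m * m) (hs : 80 * s ≤ m * m)
    (h : ((halfSets m).card : ℝ) ^ m ≤ (n + 1) ^ m * (4 ^ M * 2 ^ m) *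
      (16 ^ s * (17 / 16) ^ (m * m)) * (Nat.sqrt (Nat.sqrt (26 * 9 ^ m)) : ℝ) ^ m) :
    1 ≤ (24 : ℝ) ^ 20 * 26 ^ 5 * (m ^ 20 * (4 / 5) ^ m) := by
  set T : ℝ := (Nat.sqrt (Nat.sqrt (26 * 9 ^ m)) : ℝ) with hT
  have hT4 : T ^ 4 ≤ 26 * 9 ^ m := by
    have h1 := Nat.sqrt_le' (Nat.sqrt (26 * 9 ^ m))
    have h2 := Nat.sqrt_le' (26 * 9 ^ m)
    have h3 : Nat.sqrt (Nat.sqrt (26 * 9 ^ m)) ^ 4 ≤ 26 * 9 ^ m := by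
      refine le_trans ?_ h2
      rw [show 4 = 2 * 2 from rfl, pow_mul]
      gcongr
    rw [hT]
    exact_mod_cast h3
  have hhalf : (2 : ℝ) ^ m ≤ 2 * (halfSets m).card := by
    exact_mod_cast two_pow_le_two_mul_card_halfSets m
  have hN : (n + 1 : ℝ) ≤ 6 * m := by
    have : n + 1 ≤ 6 * m := by omega
    exact_mod_cast this
  have hroot : ((2 : ℝ) ^ m) ^ m ≤
      (24 * m) ^ m * (4 ^ M * 16 ^ s) * (17 / 16) ^ (m * m) * T ^ m :=
    calc ((2 : ℝ) ^ m) ^ m ≤ (2 * (halfSets m).card) ^ m := by gcongr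
      _ = 2 ^ m * ((halfSets m).card : ℝ) ^ m := mul_pow _ _ _
      _ ≤ 2 ^ m * ((6 * m) ^ m * (4 ^ M * 2 ^ m) * (16 ^ s * (17 / 16) ^ (m * m)) * T ^ m) := by
        gcongr
        exact h.trans (by gcongr)
      _ = _ := by
        -- `24 = 2 * 2 * 6`: one `2` from the half-sets, one from the program count, and `6` from `n
        -- + 1 ≤ 6 * m`.
        rw [show (24 * m : ℝ) = 2 * 2 * (6 * m) by ring, mul_pow (2 * 2 : ℝ), mul_pow (2 : ℝ) 2]
        ring
  have h4 : ((4 : ℝ) ^ M) ^ 20 ≤ 2 ^ (m * m) := by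
    rw [← pow_mul, show (4 : ℝ) = 2 ^ 2 by norm_num, ← pow_mul]
    exact pow_le_pow_right₀ (by norm_num) (by omega)
  have h16 : ((16 : ℝ) ^ s) ^ 20 ≤ 2 ^ (m * m) := by
    rw [← pow_mul, show (16 : ℝ) = 2 ^ 4 by norm_num, ← pow_mul]
    exact pow_le_pow_right₀ (by norm_num) (by omega)
  have hT20 : (T ^ m) ^ 20 ≤ (26 ^ 5) ^ m * (3 ^ 10) ^ (m * m) :=
    calc (T ^ m) ^ 20 = ((T ^ 4) ^ 5) ^ m := by ring
      _ ≤ ((26 * 9 ^ m) ^ 5) ^ m := by gcongr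
      _ = (26 ^ 5) ^ m * (9 ^ 5) ^ (m * m) := by
        rw [mul_pow, mul_pow]
        congr 1
        rw [← pow_mul, ← pow_mul, ← pow_mul]
        congr 1
        ring
      _ = _ := by norm_num
  have h20 : ((2 : ℝ) ^ 20) ^ (m * m) ≤
      (24 ^ 20 * 26 ^ 5 * m ^ 20) ^ m * (2 * 2 * (17 / 16) ^ 20 * 3 ^ 10) ^ (m * m) :=
    calc ((2 : ℝ) ^ 20) ^ (m * m) = (((2 : ℝ) ^ m) ^ m) ^ 20 := by
          rw [← pow_mul, ← pow_mul, ← pow_mul, mul_comm 20, mul_assoc]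
      _ ≤ ((24 * m) ^ m * (4 ^ M * 16 ^ s) * (17 / 16) ^ (m * m) * T ^ m) ^ 20 := by gcongr
      _ = ((24 * m) ^ 20) ^ m * (((4 : ℝ) ^ M) ^ 20 * ((16 : ℝ) ^ s) ^ 20) *
          ((17 / 16) ^ 20) ^ (m * m) * (T ^ m) ^ 20 := by
          rw [mul_pow, mul_pow, mul_pow, mul_pow (4 ^ M : ℝ), ← pow_mul, ← pow_mul (17 / 16 : ℝ),
            mul_comm m 20, mul_comm (m * m) 20, pow_mul, pow_mul (17 / 16 : ℝ)]
      _ ≤ ((24 * m) ^ 20) ^ m * (2 ^ (m * m) * 2 ^ (m * m)) *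
          ((17 / 16) ^ 20) ^ (m * m) * ((26 ^ 5) ^ m * (3 ^ 10) ^ (m * m)) := by gcongr
      _ = _ := by
          simp only [mul_pow]
          ring
  have hq : (2 * 2 * (17 / 16) ^ 20 * 3 ^ 10 : ℝ) ≤ 2 ^ 20 * (4 / 5) := by norm_num
  have hfin : (2 ^ 20 : ℝ) ^ (m * m) ≤
      (24 ^ 20 * 26 ^ 5 * (m ^ 20 * (4 / 5) ^ m)) ^ m * (2 ^ 20) ^ (m * m) :=
    calc _ ≤ (24 ^ 20 * 26 ^ 5 * m ^ 20 : ℝ) ^ m * (2 ^ 20 * (4 / 5)) ^ (m * m) := by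
          refine h20.trans ?_
          gcongr
      _ = _ := by
          rw [← mul_assoc (24 ^ 20 * 26 ^ 5 : ℝ), mul_pow _ ((4 / 5 : ℝ) ^ m), ← pow_mul,
            mul_pow (2 ^ 20 : ℝ)]
          ring
  have hone := le_of_mul_le_mul_right ((one_mul _).trans_le hfin) (by positivity)
  exact (one_le_pow_iff_of_nonneg (by positivity) (by omega)).1 hone

theorem eventually_counting_bound_lt :
    ∀ᶠ m : ℕ in atTop, (24 : ℝ) ^ 20 * 26 ^ 5 * (m ^ 20 * (4 / 5) ^ m) < 1 := by
  have h := (tendsto_pow_const_mul_const_pow_of_abs_lt_one 20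
    (r := (4 / 5 : ℝ)) (by rw [abs_of_pos] <;> norm_num)).const_mul ((24 : ℝ) ^ 20 * 26 ^ 5)
  rw [mul_zero] at h
  exact h.eventually_lt_const one_pos

/-! ### The lower bound -/

theorem RoutingFunction.ncard_compl_le {V : Type*} [Fintype V] {G : SimpleGraph V}
    (R : RoutingFunction G) {s ε : ℝ} (h : 1 - ε ≤ R.stretchProb s) :
    (({x : V × V | x.1 ≠ x.2 → R.StretchLT s x.1 x.2}ᶜ.ncard : ℕ) : ℝ) ≤
      ε * (Fintype.card V : ℝ) ^ 2 := by
  have hc := Set.ncard_add_ncard_compl {x : V × V | x.1 ≠ x.2 → R.StretchLT s x.1 x.2}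
  rw [Nat.card_eq_fintype_card, Fintype.card_prod] at hc
  have hc' : (({x : V × V | x.1 ≠ x.2 → R.StretchLT s x.1 x.2}.ncard : ℕ) : ℝ) +
      (({x : V × V | x.1 ≠ x.2 → R.StretchLT s x.1 x.2}ᶜ.ncard : ℕ) : ℝ) =
      (Fintype.card V : ℝ) ^ 2 := by
    rw [sq]
    exact_mod_cast hc
  rcases (Nat.cast_nonneg (α := ℝ) (Fintype.card V)).eq_or_lt with h0 | hpos
  · rw [← h0] at hc' ⊢
    have := Nat.cast_nonneg (α := ℝ)
      ({x : V × V | x.1 ≠ x.2 → R.StretchLT s x.1 x.2}.ncard)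
    linarith
  · rw [stretchProb, le_div_iff₀ (by positivity)] at h
    linarith

theorem eventually_exists_hard_network :
    ∀ᶠ n : ℕ in atTop, ∀ U : ProgLang, ∃ G : SimpleGraph (Fin n), G.Connected ∧
      ∀ R : RoutingFunction G, 1 - 1 / 400 ≤ R.stretchProb 3 →
        ENNReal.ofReal (1 / 200 * (n : ℝ) ^ 2) ≤ (R.totalMemory U : ℝ≥0∞) := by
  have hdiv : Tendsto (fun n : ℕ => (n - 2) / 2) atTop atTop :=
    (Nat.tendsto_div_const_atTop two_ne_zero).comp (tendsto_sub_atTop_nat 2)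
  filter_upwards [hdiv.eventually eventually_counting_bound_lt,
    hdiv.eventually (eventually_ge_atTop 13), eventually_ge_atTop 2] with n hlt hm hn2 U
  set m := (n - 2) / 2 with hmdef
  have hn : 2 * m + 2 ≤ n := by omega
  have hn' : n ≤ 2 * m + 3 := by omega
  -- `(2 * m + 3) ^ 2 ≤ 5 * m ^ 2` needs `m ≥ 13`. It turns `n ^ 2 / 200` and `n ^ 2 / 400` into the
  -- budgets `m ^ 2 / 40` for memory and `m ^ 2 / 80` for bad pairs.
  have hsq : (n : ℝ) ^ 2 ≤ 5 * (m * m) := by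
    have : n ^ 2 ≤ 5 * (m * m) := by nlinarith
    exact_mod_cast this
  -- If no network is hard, every `hubGraph n E` has a cheap routing function, which the count
  -- forbids.
  by_contra! hcon
  refine hlt.not_ge (counting_bound_of_le (n := n) (M := ⌊(m * m : ℝ) / 40⌋₊)
    (s := ⌊(m * m : ℝ) / 80⌋₊) hn' (by omega) ?_ ?_ (card_halfSets_pow_le hn hn' U fun E _ => ?_))
  · have := Nat.floor_le (show (0 : ℝ) ≤ m * m / 40 by positivity)
    have h : (40 : ℝ) * ⌊(m * m : ℝ) / 40⌋₊ ≤ m * m := by linarith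
    exact_mod_cast h
  · have := Nat.floor_le (show (0 : ℝ) ≤ m * m / 80 by positivity)
    have h : (80 : ℝ) * ⌊(m * m : ℝ) / 80⌋₊ ≤ m * m := by linarith
    exact_mod_cast h
  obtain ⟨R, hR, hmem⟩ := hcon (hubGraph n E) (hubGraph_connected hn)
  refine ⟨R, ?_, Nat.le_floor ?_⟩
  · have hfin : R.totalMemory U ≠ ⊤ := fun h => by simp [h] at hmem
    lift R.totalMemory U to ℕ using hfin with t
    rw [ENat.toENNReal_coe, ← ENNReal.ofReal_natCast] at hmem
    have ht := (ENNReal.ofReal_lt_ofReal_iff'.1 hmem).1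
    exact_mod_cast Nat.le_floor (show (t : ℝ) ≤ m * m / 40 by linarith)
  · have := R.ncard_compl_le hR
    rw [Fintype.card_fin] at this
    linarith

theorem theorem4 :
    ∃ c : ℝ, 0 < c ∧ ∀ U : ProgLang,
      ∃ G : (n : ℕ) → SimpleGraph (Fin n), (∀ n : ℕ, 1 ≤ n → (G n).Connected) ∧
        ∀ R : (n : ℕ) → RoutingFunction (G n),
          Tendsto (fun n : ℕ => (R n).stretchProb 3) atTop (𝓝 1) →
          ∀ᶠ n : ℕ in atTop,
            ENNReal.ofReal (c * (n : ℝ) ^ 2) ≤ ((R n).totalMemory U : ℝ≥0∞) := by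
  classical
  refine ⟨1 / 200, by norm_num, fun U => ?_⟩
  let Hard : (n : ℕ) → SimpleGraph (Fin n) → Prop := fun n G => G.Connected ∧
    ∀ R : RoutingFunction G, 1 - 1 / 400 ≤ R.stretchProb 3 →
      ENNReal.ofReal (1 / 200 * (n : ℝ) ^ 2) ≤ (R.totalMemory U : ℝ≥0∞)
  -- The network is fixed before `R`; where no hard one exists, the complete graph supplies
  -- connectivity.
  have hex : ∀ n : ℕ, ∃ G : SimpleGraph (Fin n), (1 ≤ n → G.Connected) ∧
      ((∃ G', Hard n G') → Hard n G) := fun n => by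
    by_cases h : ∃ G', Hard n G'
    · exact ⟨h.choose, fun _ => h.choose_spec.1, fun _ => h.choose_spec⟩
    · refine ⟨⊤, fun hn => ?_, fun h' => absurd h' h⟩
      have : Nonempty (Fin n) := ⟨⟨0, hn⟩⟩
      exact SimpleGraph.connected_top
  choose G hconn hhard using hex
  refine ⟨G, hconn, fun R hR => ?_⟩
  filter_upwards [eventually_exists_hard_network,
    hR.eventually_const_le (show (1 - 1 / 400 : ℝ) < 1 by norm_num)] with n hn hp
  exact (hhard n (hn U)).2 (R n) hp
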